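/- Let $p>3$ be a prime and let $\mathbb{Z}_p$ be the ring of $p$-adic integers. In the polynomial ring $\mathbb{Z}_p[\beta]$ put $\alpha=1-\beta$ and $x=\beta(1-\beta)$. Let $C_k=\frac{1}{k+1}\binom{2k}{k}$ be the $k$th Catalan number, let $H_k^{(2)}=\sum_{j=1}^{k}\frac{1}{j^2}$, and let $\pounds_2(y)=\sum_{k=1}^{p-1}\frac{y^k}{k^2}$ be the finite dilogarithm. Then the polynomial $2\pounds_2(\alpha)-2\pounds_2(\beta)$ is divisible by $\beta-\alpha$ in $\mathbb{Z}_p[\beta]$, and the following congruences hold modulo the ideal $(p)$ of $\mathbb{Z}_p[\beta]$: $$\sum_{k=1}^{p-1}\binom{2k}{k}H_k^{(2)}x^k\equiv\frac{2\pounds_2(\alpha)-2\pounds_2(\beta)}{\beta-\alpha}\pmod p,$$ $$\sum_{k=1}^{p-1}C_kH_k^{(2)}x^{k+1}\equiv 2\alpha\pounds_2(\alpha)+2\beta\pounds_2(\beta)\pmod p.$$ -/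

import Mathlib

open Polynomial

/-- The reciprocal `1 / k ^ d` of a power of a natural number, as an element of the ring `ℤ_[p]`
of `p`-adic integers. It is used only for `0 < k < p`, where `k` is a unit of `ℤ_[p]`. -/
noncomputable def padicRecip (p : ℕ) [Fact p.Prime] (d k : ℕ) : ℤ_[p] :=
  Ring.inverse ((k : ℤ_[p]) ^ d)

/-- In the range of use, `padicRecip p d k` is the rational number `1 / k ^ d`. -/
theorem coe_padicRecip (p : ℕ) [Fact p.Prime] (d k : ℕ) (hk : 0 < k) (hkp : k < p) :
    ((padicRecip p d k : ℤ_[p]) : ℚ_[p]) = 1 / (k : ℚ_[p]) ^ d := by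
  have hu : IsUnit ((k : ℤ_[p]) ^ d) := by
    refine IsUnit.pow d ?_
    rw [PadicInt.isUnit_iff, PadicInt.norm_natCast_eq_one_iff]
    exact Nat.coprime_of_lt_prime hk.ne' hkp Fact.out
  have h := congrArg (fun z : ℤ_[p] => (z : ℚ_[p])) (Ring.inverse_mul_cancel _ hu)
  simp only [PadicInt.coe_mul, PadicInt.coe_pow, PadicInt.coe_natCast, PadicInt.coe_one] at h
  exact eq_one_div_of_mul_eq_one_left h

/-- The generalized harmonic number `H_k^{(d)} = ∑_{j=1}^k 1 / j ^ d` (for `k < p`), in `ℤ_[p]`. -/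
noncomputable def padicHarmonic (p : ℕ) [Fact p.Prime] (d k : ℕ) : ℤ_[p] :=
  ∑ j ∈ Finset.Icc 1 k, padicRecip p d j

/-- The finite polylogarithm `£_d(f) = ∑_{k=1}^{p-1} f ^ k / k ^ d`, evaluated at a polynomial `f`
with `p`-adic integer coefficients. -/
noncomputable def finitePolylog (p : ℕ) [Fact p.Prime] (d : ℕ) (f : ℤ_[p][X]) : ℤ_[p][X] :=
  ∑ k ∈ Finset.Icc 1 (p - 1), C (padicRecip p d k) * f ^ k

/-! Both congruences are equalities in `(ZMod p)[X]`, with β = X. There a polynomial of degree below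
2p with zero derivative has the form a + bX^p, so it vanishes once its values at 0 and 1 do. The end
values are multiples of H_{p-1}^{(d)}, which is 0 for 0 < d < p - 1. Derivatives are compared after
multiplying by x = X(1 - X). By `mul_derivative_mul_sum` this turns (2X - 1)∑ a_k x^k into a sum
governed by the central binomial recurrence. It yields in turn ∑ binom(2k,k) x^k, then ∑ binom(2k,k)
x^k/k = 2£_1(X), then the H^{(2)} sum, whose derivative is controlled by the previous one. The
Catalan sum follows, since its derivative is (1 - 2X) times the H^{(2)} sum. -/

/-- The generalized harmonic number `∑_{j=1}^n 1 / j ^ d` in a field. -/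
def fieldHarmonic (K : Type*) [Field K] (d n : ℕ) : K :=
  ∑ j ∈ Finset.Icc 1 n, ((j : K) ^ d)⁻¹

/-- The truncated polylogarithm `∑_{k=1}^n f ^ k / k ^ d` over a field. -/
noncomputable def truncPolylog {K : Type*} [Field K] (n d : ℕ) (f : K[X]) : K[X] :=
  ∑ k ∈ Finset.Icc 1 n, C (((k : K) ^ d)⁻¹) * f ^ k

/-- A zero derivative leaves only exponents divisible by p, here 0 and p; the value at 0 kills the
first coefficient and the value at 1 the second. -/
theorem Polynomial.eq_zero_of_derivative_eq_zero_of_natDegree_lt {K : Type*} [Field K] (p : ℕ)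
    [CharP K p] {f : K[X]} (hd : derivative f = 0) (hdeg : f.natDegree < 2 * p)
    (h0 : f.eval 0 = 0) (h1 : f.eval 1 = 0) : f = 0 := by
  have hp0 : 0 < p := by omega
  have hc : ∀ n, n ≠ p → f.coeff n = 0 := by
    intro n hn
    rcases Nat.eq_zero_or_pos n with rfl | hpos
    · rwa [coeff_zero_eq_eval_zero]
    by_cases hlt : 2 * p ≤ n
    · exact coeff_eq_zero_of_natDegree_lt (by omega)
    have h := congrArg (fun q => q.coeff (n - 1)) hd
    simp only [coeff_derivative, coeff_zero, Nat.sub_add_cancel hpos] at h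
    have hcast : ((n - 1 : ℕ) : K) + 1 = (n : K) := by
      rw [← Nat.cast_succ, Nat.succ_eq_add_one, Nat.sub_add_cancel hpos]
    rw [hcast] at h
    refine (mul_eq_zero.1 h).resolve_right fun hz => ?_
    obtain ⟨m, rfl⟩ := (CharP.cast_eq_zero_iff K p n).1 hz
    rcases m with _ | _ | m
    · simp at hpos
    · simp at hn
    · apply hlt
      nlinarith
  have hf : f = C (f.coeff p) * X ^ p := by
    ext n
    rw [coeff_C_mul_X_pow]
    split_ifs with h
    · rw [h]
    · exact hc n h
  rw [hf] at h1 ⊢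
  simp only [eval_mul, eval_C, eval_pow, eval_X, one_pow, mul_one] at h1
  simp [h1]

theorem fieldHarmonic_succ (K : Type*) [Field K] (d n : ℕ) :
    fieldHarmonic K d (n + 1) = fieldHarmonic K d n + (((n + 1 : ℕ) : K) ^ d)⁻¹ := by
  rw [fieldHarmonic, fieldHarmonic, Finset.sum_Icc_succ_top (by omega)]

/-- Inversion permutes `ZMod p`, so this is the power sum of a^d over the field, zero for d < p - 1.
As d > 0, a = 0 contributes nothing. -/
theorem fieldHarmonic_zmod_eq_zero (p : ℕ) [Fact p.Prime] (d : ℕ) (hd : 0 < d) (hdp : d < p - 1) :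
    fieldHarmonic (ZMod p) d (p - 1) = 0 := by
  have hp : 0 < p := by omega
  have h1 : ∑ a : ZMod p, (a ^ d)⁻¹ = 0 := by
    have := FiniteField.sum_pow_lt_card_sub_one (ZMod p) d (by rwa [ZMod.card])
    rw [← this]
    refine Fintype.sum_equiv (Equiv.inv (ZMod p)) _ _ fun a => ?_
    simp
  rw [← h1, fieldHarmonic]
  have h2 : ∑ a : ZMod p, (a ^ d)⁻¹ = ∑ j ∈ Finset.range p, ((j : ZMod p) ^ d)⁻¹ := by
    symm
    refine Finset.sum_bij' (fun j _ => (j : ZMod p)) (fun a _ => a.val) ?_ ?_ ?_ ?_ ?_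
    · simp
    · intro a _
      simpa using ZMod.val_lt a
    · intro j hj
      exact ZMod.val_cast_of_lt (Finset.mem_range.1 hj)
    · intro a _
      simp
    · simp
  rw [h2]
  refine Finset.sum_subset (fun j hj => ?_) fun j hj hj' => ?_
  · simp only [Finset.mem_Icc, Finset.mem_range] at *
    omega
  · simp only [Finset.mem_Icc, Finset.mem_range] at *
    obtain rfl : j = 0 := by omega
    simp [hd.ne']

/-! ### Derivatives, degrees and end values of truncated sums -/

theorem mul_derivative_sum_C_mul_pow {K : Type*} [Field K] (s : Finset ℕ) (a : ℕ → K) (f : K[X]) :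
    f * derivative (∑ k ∈ s, C (a k) * f ^ k)
      = derivative f * ∑ k ∈ s, C ((k : K) * a k) * f ^ k := by
  rw [derivative_sum, Finset.mul_sum, Finset.mul_sum]
  refine Finset.sum_congr rfl fun k _ => ?_
  rcases k with _ | k
  · simp
  · simp only [derivative_C_mul, derivative_pow, C_mul, Nat.add_sub_cancel, map_natCast]
    ring

theorem mul_derivative_truncPolylog (p : ℕ) [Fact p.Prime] (d : ℕ) (f : (ZMod p)[X]) :
    f * derivative (truncPolylog (p - 1) (d + 1) f)
      = derivative f * truncPolylog (p - 1) d f := by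
  rw [truncPolylog, mul_derivative_sum_C_mul_pow, truncPolylog]
  congr 1
  refine Finset.sum_congr rfl fun k hk => ?_
  have hk0 : (k : ZMod p) ≠ 0 := by
    rw [Ne, ZMod.natCast_eq_zero_iff]
    rw [Finset.mem_Icc] at hk
    exact Nat.not_dvd_of_pos_of_lt (by omega) (by omega)
  congr 2
  field_simp
  ring

theorem one_sub_mul_truncPolylog_zero {K : Type*} [Field K] (n : ℕ) (f : K[X]) :
    (1 - f) * truncPolylog n 0 f = f - f ^ (n + 1) := by
  induction n with
  | zero => simp [truncPolylog]
  | succ n ih =>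
    rw [truncPolylog, Finset.sum_Icc_succ_top (by omega), mul_add]
    rw [truncPolylog] at ih
    rw [ih]
    simp
    ring

theorem natDegree_sum_C_mul_pow_le {K : Type*} [Field K] (s : Finset ℕ) (a : ℕ → K) (f : K[X])
    (n m : ℕ) (hs : ∀ k ∈ s, k ≤ n) (hf : f.natDegree ≤ m) :
    (∑ k ∈ s, C (a k) * f ^ k).natDegree ≤ n * m := by
  refine natDegree_sum_le_of_forall_le _ _ fun k hk => ?_
  exact (natDegree_C_mul_le _ _).trans (natDegree_pow_le.trans (Nat.mul_le_mul (hs k hk) hf))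

theorem eval_truncPolylog {K : Type*} [Field K] (n d : ℕ) (f : K[X]) (t : K) :
    (truncPolylog n d f).eval t = ∑ k ∈ Finset.Icc 1 n, ((k : K) ^ d)⁻¹ * f.eval t ^ k := by
  simp [truncPolylog, eval_finsetSum]

theorem eval_truncPolylog_of_eval_eq_one {K : Type*} [Field K] (n d : ℕ) {f : K[X]} {t : K}
    (h : f.eval t = 1) : (truncPolylog n d f).eval t = fieldHarmonic K d n := by
  simp [eval_truncPolylog, h, fieldHarmonic]

theorem eval_sum_C_mul_pow_of_eval_eq_zero {K : Type*} [Field K] (n : ℕ) (a : ℕ → K) {f : K[X]}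
    {t : K} (h : f.eval t = 0) :
    (∑ k ∈ Finset.Icc 1 n, C (a k) * f ^ k).eval t = 0 := by
  rw [eval_finsetSum]
  refine Finset.sum_eq_zero fun k hk => ?_
  rw [Finset.mem_Icc] at hk
  simp [h, show k ≠ 0 by omega]

theorem eval_truncPolylog_of_eval_eq_zero {K : Type*} [Field K] (n d : ℕ) {f : K[X]} {t : K}
    (h : f.eval t = 0) : (truncPolylog n d f).eval t = 0 :=
  eval_sum_C_mul_pow_of_eval_eq_zero n _ h

/-- With (2X - 1)² = 1 - 4x and x' = 1 - 2X, the left side is 2xS - x(1 - 4x) dS/dx; the last term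
on the right is the truncation boundary. -/
theorem mul_derivative_mul_sum {K : Type*} [Field K] (a : ℕ → K) (n : ℕ) :
    (X * (1 - X) : K[X]) *
        derivative ((2 * X - 1) * ∑ k ∈ Finset.range (n + 1), C (a k) * (X * (1 - X)) ^ k)
      = ∑ k ∈ Finset.range n,
          C ((4 * k + 2) * a k - (k + 1) * a (k + 1)) * (X * (1 - X)) ^ (k + 1)
        + C ((4 * n + 2) * a n) * (X * (1 - X)) ^ (n + 1) := by
  induction n with
  | zero =>
    simp [C_ofNat]
    ring
  | succ n ih =>
    rw [Finset.sum_range_succ, mul_add, derivative_add, mul_add, ih, Finset.sum_range_succ]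
    simp [derivative_pow, C_ofNat]
    ring

theorem sum_Icc_eq_sum_range {M : Type*} [AddCommMonoid M] (f : ℕ → M) (n : ℕ) :
    ∑ k ∈ Finset.Icc 1 n, f k = ∑ k ∈ Finset.range n, f (k + 1) := by
  induction n with
  | zero => simp
  | succ n ih => rw [Finset.sum_Icc_succ_top (by omega), ih, Finset.sum_range_succ]

theorem succ_mul_centralBinom_cast {K : Type*} [Field K] (k : ℕ) :
    ((k : K) + 1) * (k + 1).centralBinom = (4 * k + 2) * k.centralBinom := by
  have h := congrArg (Nat.cast : ℕ → K) (Nat.succ_mul_centralBinom_succ k)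
  push_cast at h
  rw [h]
  ring

theorem natDegree_X_mul_one_sub_X_le {K : Type*} [Field K] :
    (X * (1 - X) : K[X]).natDegree ≤ 2 := by
  compute_degree

theorem centralBinom_pred_cast_eq_zero (p : ℕ) [Fact p.Prime] (hp : 2 < p) :
    ((p - 1).centralBinom : ZMod p) = 0 := by
  rw [ZMod.natCast_eq_zero_iff, Nat.centralBinom]
  have hpp : p.Prime := Fact.out
  exact hpp.dvd_choose (by omega) (by omega) (by omega)

theorem natDegree_truncPolylog_le (p : ℕ) [Fact p.Prime] (d : ℕ) {f : (ZMod p)[X]}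
    (hf : f.natDegree ≤ 1) : (truncPolylog (p - 1) d f).natDegree ≤ p - 1 := by
  have := natDegree_sum_C_mul_pow_le (Finset.Icc 1 (p - 1))
    (fun k => (((k : ZMod p) ^ d)⁻¹)) f (p - 1) 1 (fun k hk => (Finset.mem_Icc.1 hk).2) hf
  rwa [mul_one] at this

theorem natDegree_one_sub_X_le {K : Type*} [Field K] : (1 - X : K[X]).natDegree ≤ 1 := by
  compute_degree

theorem X_mul_one_sub_X_ne_zero {K : Type*} [Field K] : (X * (1 - X) : K[X]) ≠ 0 := by
  refine mul_ne_zero X_ne_zero fun h => ?_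
  simpa using congrArg (eval 0) h

theorem one_sub_X_pow_prime (p : ℕ) [Fact p.Prime] : (1 - X : (ZMod p)[X]) ^ p = 1 - X ^ p := by
  rw [sub_pow_char, one_pow]

theorem natDegree_two_X_sub_one_mul_le {K : Type*} [Field K] {f : K[X]} {n : ℕ}
    (hf : f.natDegree ≤ n) : ((2 * X - 1) * f).natDegree ≤ 1 + n := by
  refine natDegree_mul_le.trans (Nat.add_le_add ?_ hf)
  compute_degree

/-! ### Identities modulo p -/

theorem X_mul_one_sub_X_mul_derivative_truncPolylog_one_X (p : ℕ) [Fact p.Prime] :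
    X * (1 - X) * derivative (truncPolylog (p - 1) 1 (X : (ZMod p)[X])) = X - X ^ p := by
  have h1 := mul_derivative_truncPolylog p 0 (X : (ZMod p)[X])
  have h2 := one_sub_mul_truncPolylog_zero (p - 1) (X : (ZMod p)[X])
  rw [Nat.sub_add_cancel (Fact.out : p.Prime).one_le] at h2
  simp only [zero_add, derivative_X, one_mul] at h1
  linear_combination (1 - X) * h1 + h2

theorem X_mul_one_sub_X_mul_derivative_truncPolylog_one_one_sub_X (p : ℕ) [Fact p.Prime] :
    X * (1 - X) * derivative (truncPolylog (p - 1) 1 (1 - X : (ZMod p)[X])) = X - X ^ p := by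
  have h1 := mul_derivative_truncPolylog p 0 (1 - X : (ZMod p)[X])
  have h2 := one_sub_mul_truncPolylog_zero (p - 1) (1 - X : (ZMod p)[X])
  rw [Nat.sub_add_cancel (Fact.out : p.Prime).one_le, one_sub_X_pow_prime] at h2
  simp only [zero_add, derivative_sub, derivative_one, derivative_X, zero_sub] at h1
  linear_combination X * h1 - h2

theorem truncPolylog_one_one_sub_X (p : ℕ) [Fact p.Prime] (hp : 2 < p) :
    truncPolylog (p - 1) 1 (1 - X : (ZMod p)[X]) = truncPolylog (p - 1) 1 X := by
  have hH := fieldHarmonic_zmod_eq_zero p 1 one_pos (by omega)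
  refine sub_eq_zero.1 (eq_zero_of_derivative_eq_zero_of_natDegree_lt p ?_ ?_ ?_ ?_)
  · refine (mul_eq_zero.1 ?_).resolve_left (X_mul_one_sub_X_ne_zero (K := ZMod p))
    rw [derivative_sub]
    linear_combination X_mul_one_sub_X_mul_derivative_truncPolylog_one_one_sub_X p
      - X_mul_one_sub_X_mul_derivative_truncPolylog_one_X p
  · have h1 := natDegree_truncPolylog_le p 1 (natDegree_one_sub_X_le (K := ZMod p))
    have h2 := natDegree_truncPolylog_le p 1 (natDegree_X_le (R := ZMod p))
    have := natDegree_sub_le_of_le h1 h2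
    rw [max_self] at this
    omega
  · rw [eval_sub, eval_truncPolylog_of_eval_eq_one _ _ (by simp),
      eval_truncPolylog_of_eval_eq_zero _ _ (by simp), hH, sub_zero]
  · rw [eval_sub, eval_truncPolylog_of_eval_eq_zero _ _ (by simp),
      eval_truncPolylog_of_eval_eq_one _ _ (by simp), hH, sub_zero]

/-- The right side is (2X - 1)^p, so this is the truncated series of (1 - 4x)^(-1/2) modulo p. The
added 1 is the term k = 0. -/
theorem two_X_sub_one_mul_sum_centralBinom (p : ℕ) [Fact p.Prime] (hp : 2 < p) :
    (2 * X - 1) * (∑ k ∈ Finset.Icc 1 (p - 1),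
        C ((k.centralBinom : ZMod p)) * (X * (1 - X)) ^ k + 1)
      = 2 * X ^ p - 1 := by
  have hs : ∑ k ∈ Finset.Icc 1 (p - 1), C ((k.centralBinom : ZMod p)) * (X * (1 - X)) ^ k + 1
      = ∑ k ∈ Finset.range (p - 1 + 1), C ((k.centralBinom : ZMod p)) * (X * (1 - X)) ^ k := by
    rw [Finset.sum_range_succ', sum_Icc_eq_sum_range]
    simp
  refine sub_eq_zero.1 (eq_zero_of_derivative_eq_zero_of_natDegree_lt p ?_ ?_ ?_ ?_)
  · refine (mul_eq_zero.1 ?_).resolve_left (X_mul_one_sub_X_ne_zero (K := ZMod p))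
    have h := mul_derivative_mul_sum (fun k => (k.centralBinom : ZMod p)) (p - 1)
    -- The boundary term vanishes because p divides binom(2p - 2, p - 1).
    rw [centralBinom_pred_cast_eq_zero p hp, mul_zero, C_0, zero_mul, add_zero] at h
    have hX : derivative (2 * X ^ p - 1 : (ZMod p)[X]) = 0 := by
      rw [derivative_sub, derivative_mul, derivative_X_pow]
      simp
    rw [hs, derivative_sub, hX, sub_zero, h]
    refine Finset.sum_eq_zero fun k _ => ?_
    rw [succ_mul_centralBinom_cast, sub_self, C_0, zero_mul]
  · have h1 := natDegree_two_X_sub_one_mul_le (natDegree_sum_C_mul_pow_le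
      (Finset.range (p - 1 + 1)) (fun k => (k.centralBinom : ZMod p)) (X * (1 - X)) (p - 1) 2
      (fun k hk => by have := Finset.mem_range.1 hk; omega) natDegree_X_mul_one_sub_X_le)
    rw [← hs] at h1
    have h2 : (2 * X ^ p - 1 : (ZMod p)[X]).natDegree ≤ p := by compute_degree
    have := natDegree_sub_le_of_le h1 h2
    refine this.trans_lt (max_lt ?_ ?_) <;> omega
  · simp only [eval_sub, eval_mul, eval_add]
    rw [eval_sum_C_mul_pow_of_eval_eq_zero _ _ (by simp)]
    simp [show p ≠ 0 by omega]
  · simp only [eval_sub, eval_mul, eval_add]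
    rw [eval_sum_C_mul_pow_of_eval_eq_zero _ _ (by simp)]
    simp

theorem sum_centralBinom_div_eq (p : ℕ) [Fact p.Prime] (hp : 2 < p) :
    ∑ k ∈ Finset.Icc 1 (p - 1), C ((k.centralBinom : ZMod p) * (k : ZMod p)⁻¹) * (X * (1 - X)) ^ k
      = 2 * truncPolylog (p - 1) 1 X := by
  have hH := fieldHarmonic_zmod_eq_zero p 1 one_pos (by omega)
  refine sub_eq_zero.1 (eq_zero_of_derivative_eq_zero_of_natDegree_lt p ?_ ?_ ?_ ?_)
  · refine (mul_eq_zero.1 ?_).resolve_left (X_mul_one_sub_X_ne_zero (K := ZMod p))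
    rw [derivative_sub, mul_sub, mul_derivative_sum_C_mul_pow]
    have h1 := two_X_sub_one_mul_sum_centralBinom p hp
    have h2 : ∑ k ∈ Finset.Icc 1 (p - 1),
          C ((k : ZMod p) * ((k.centralBinom : ZMod p) * (k : ZMod p)⁻¹)) * (X * (1 - X)) ^ k
        = ∑ k ∈ Finset.Icc 1 (p - 1), C ((k.centralBinom : ZMod p)) * (X * (1 - X)) ^ k := by
      refine Finset.sum_congr rfl fun k hk => ?_
      have hk0 : (k : ZMod p) ≠ 0 := by
        rw [Ne, ZMod.natCast_eq_zero_iff]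
        rw [Finset.mem_Icc] at hk
        exact Nat.not_dvd_of_pos_of_lt (by omega) (by omega)
      congr 2
      field_simp
    have h3 := X_mul_one_sub_X_mul_derivative_truncPolylog_one_X p
    have h4 : derivative (X * (1 - X) : (ZMod p)[X]) = 1 - 2 * X := by
      simp
      ring
    have h5 : derivative (2 * truncPolylog (p - 1) 1 (X : (ZMod p)[X]))
        = 2 * derivative (truncPolylog (p - 1) 1 X) := by simp
    rw [h2, h4, h5]
    linear_combination -h1 - 2 * h3
  · have h1 := natDegree_sum_C_mul_pow_le (Finset.Icc 1 (p - 1))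
      (fun k => (k.centralBinom : ZMod p) * (k : ZMod p)⁻¹) (X * (1 - X)) (p - 1) 2
      (fun k hk => (Finset.mem_Icc.1 hk).2) natDegree_X_mul_one_sub_X_le
    have h2 : (2 * truncPolylog (p - 1) 1 (X : (ZMod p)[X])).natDegree ≤ 0 + (p - 1) :=
      natDegree_mul_le.trans (Nat.add_le_add (by compute_degree)
        (natDegree_truncPolylog_le p 1 natDegree_X_le))
    have := natDegree_sub_le_of_le h1 h2
    refine this.trans_lt (max_lt ?_ ?_) <;> omega
  · rw [eval_sub, eval_mul, eval_truncPolylog_of_eval_eq_zero _ _ (by simp),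
      eval_sum_C_mul_pow_of_eval_eq_zero _ _ (by simp), mul_zero, sub_zero]
  · rw [eval_sub, eval_mul, eval_truncPolylog_of_eval_eq_one _ _ (by simp), hH,
      eval_sum_C_mul_pow_of_eval_eq_zero _ _ (by simp), mul_zero, sub_zero]

theorem mul_derivative_truncPolylog_two_sub (p : ℕ) [Fact p.Prime] (hp : 2 < p) :
    X * (1 - X) * (derivative (truncPolylog (p - 1) 2 (1 - X : (ZMod p)[X]))
        - derivative (truncPolylog (p - 1) 2 X))
      = - truncPolylog (p - 1) 1 X := by
  have h1 := mul_derivative_truncPolylog p 1 (X : (ZMod p)[X])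
  have h2 := mul_derivative_truncPolylog p 1 (1 - X : (ZMod p)[X])
  rw [truncPolylog_one_one_sub_X p hp] at h2
  simp only [one_add_one_eq_two, derivative_sub, derivative_one, derivative_X, zero_sub,
    one_mul] at h1 h2
  linear_combination X * h2 - (1 - X) * h1

theorem two_X_sub_one_mul_sum_centralBinom_harmonic (p : ℕ) [Fact p.Prime] (hp : 3 < p) :
    (2 * X - 1) * ∑ k ∈ Finset.Icc 1 (p - 1),
        C ((k.centralBinom : ZMod p) * fieldHarmonic (ZMod p) 2 k) * (X * (1 - X)) ^ k
      = 2 * truncPolylog (p - 1) 2 (1 - X) - 2 * truncPolylog (p - 1) 2 X := by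
  have hH := fieldHarmonic_zmod_eq_zero p 2 two_pos (by omega)
  refine sub_eq_zero.1 (eq_zero_of_derivative_eq_zero_of_natDegree_lt p ?_ ?_ ?_ ?_)
  · refine (mul_eq_zero.1 ?_).resolve_left (X_mul_one_sub_X_ne_zero (K := ZMod p))
    have h1 := mul_derivative_mul_sum
      (fun k => (k.centralBinom : ZMod p) * fieldHarmonic (ZMod p) 2 k) (p - 1)
    have h2 := sum_centralBinom_div_eq p (by omega)
    have h3 := mul_derivative_truncPolylog_two_sub p (by omega)
    have h4 : ∑ k ∈ Finset.range (p - 1), C ((4 * k + 2) *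
          ((k.centralBinom : ZMod p) * fieldHarmonic (ZMod p) 2 k) - (k + 1) *
          (((k + 1).centralBinom : ZMod p) * fieldHarmonic (ZMod p) 2 (k + 1))) *
          (X * (1 - X)) ^ (k + 1)
        = - ∑ k ∈ Finset.range (p - 1), C (((k + 1).centralBinom : ZMod p) *
          ((k + 1 : ℕ) : ZMod p)⁻¹) * (X * (1 - X)) ^ (k + 1) := by
      rw [← Finset.sum_neg_distrib]
      refine Finset.sum_congr rfl fun k hk => ?_
      have hk0 : (k : ZMod p) + 1 ≠ 0 := by
        rw [← Nat.cast_succ, Ne, ZMod.natCast_eq_zero_iff]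
        rw [Finset.mem_range] at hk
        exact Nat.not_dvd_of_pos_of_lt (by omega) (by omega)
      rw [← neg_mul, ← C_neg]
      congr 2
      -- The recurrence cancels the H_k parts; the increment 1/(k+1)² times k + 1 leaves
      -- -binom(2k+2, k+1)/(k+1).
      rw [← mul_assoc, ← succ_mul_centralBinom_cast, fieldHarmonic_succ]
      push_cast
      field_simp
      ring
    rw [h4, ← sum_Icc_eq_sum_range (fun k => C ((k.centralBinom : ZMod p) *
      (k : ZMod p)⁻¹) * (X * (1 - X)) ^ k), h2, hH, mul_zero, mul_zero, C_0, zero_mul, add_zero,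
      Finset.sum_range_succ', ← sum_Icc_eq_sum_range
      (fun k => C ((k.centralBinom : ZMod p) * fieldHarmonic (ZMod p) 2 k) * (X * (1 - X)) ^ k),
      show fieldHarmonic (ZMod p) 2 0 = 0 by simp [fieldHarmonic], mul_zero, C_0, zero_mul,
      add_zero] at h1
    rw [derivative_sub, mul_sub, h1]
    simp only [derivative_sub, derivative_mul, derivative_ofNat]
    linear_combination -2 * h3
  · have h1 := natDegree_two_X_sub_one_mul_le (natDegree_sum_C_mul_pow_le (Finset.Icc 1 (p - 1))
      (fun k => (k.centralBinom : ZMod p) * fieldHarmonic (ZMod p) 2 k) (X * (1 - X)) (p - 1) 2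
      (fun k hk => (Finset.mem_Icc.1 hk).2) natDegree_X_mul_one_sub_X_le)
    have h2 : ∀ f : (ZMod p)[X], f.natDegree ≤ 1 →
        (2 * truncPolylog (p - 1) 2 f).natDegree ≤ 0 + (p - 1) := fun f hf =>
      natDegree_mul_le.trans (Nat.add_le_add (by compute_degree)
        (natDegree_truncPolylog_le p 2 hf))
    have := natDegree_sub_le_of_le h1
      (natDegree_sub_le_of_le (h2 _ natDegree_one_sub_X_le) (h2 _ natDegree_X_le))
    rw [max_self] at this
    refine this.trans_lt (max_lt ?_ ?_) <;> omega
  · simp only [eval_sub, eval_mul]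
    rw [eval_truncPolylog_of_eval_eq_one (f := 1 - X) _ _ (by simp), hH,
      eval_truncPolylog_of_eval_eq_zero (f := X) _ _ (by simp),
      eval_sum_C_mul_pow_of_eval_eq_zero _ _ (by simp)]
    simp
  · simp only [eval_sub, eval_mul]
    rw [eval_truncPolylog_of_eval_eq_zero (f := 1 - X) _ _ (by simp),
      eval_truncPolylog_of_eval_eq_one (f := X) _ _ (by simp), hH,
      eval_sum_C_mul_pow_of_eval_eq_zero _ _ (by simp)]
    simp

theorem sum_catalan_harmonic (p : ℕ) [Fact p.Prime] (hp : 3 < p) :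
    ∑ k ∈ Finset.Icc 1 (p - 1),
        C ((catalan k : ZMod p) * fieldHarmonic (ZMod p) 2 k) * (X * (1 - X)) ^ (k + 1)
      = 2 * (1 - X) * truncPolylog (p - 1) 2 (1 - X) + 2 * X * truncPolylog (p - 1) 2 X := by
  have hH := fieldHarmonic_zmod_eq_zero p 2 two_pos (by omega)
  refine sub_eq_zero.1 (eq_zero_of_derivative_eq_zero_of_natDegree_lt p ?_ ?_ ?_ ?_)
  · have h0 := two_X_sub_one_mul_sum_centralBinom_harmonic p hp
    have h1 := mul_derivative_truncPolylog p 1 (X : (ZMod p)[X])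
    have h2 := mul_derivative_truncPolylog p 1 (1 - X : (ZMod p)[X])
    rw [truncPolylog_one_one_sub_X p (by omega)] at h2
    simp only [one_add_one_eq_two, derivative_sub, derivative_one, derivative_X, zero_sub,
      one_mul] at h1 h2
    have h3 : derivative (∑ k ∈ Finset.Icc 1 (p - 1),
          C ((catalan k : ZMod p) * fieldHarmonic (ZMod p) 2 k) * (X * (1 - X)) ^ (k + 1))
        = (1 - 2 * X) * ∑ k ∈ Finset.Icc 1 (p - 1),
          C ((k.centralBinom : ZMod p) * fieldHarmonic (ZMod p) 2 k) * (X * (1 - X)) ^ k := by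
      rw [derivative_sum, Finset.mul_sum]
      refine Finset.sum_congr rfl fun k _ => ?_
      rw [← succ_mul_catalan_eq_centralBinom]
      simp [derivative_pow]
      ring
    rw [derivative_sub, h3]
    simp only [derivative_add, derivative_mul, derivative_ofNat, derivative_sub, derivative_one,
      derivative_X]
    linear_combination -h0 - 2 * h1 - 2 * h2
  · have h1 : (∑ k ∈ Finset.Icc 1 (p - 1),
          C ((catalan k : ZMod p) * fieldHarmonic (ZMod p) 2 k) *
            (X * (1 - X)) ^ (k + 1)).natDegree ≤ (p - 1) * 2 := by
      refine natDegree_sum_le_of_forall_le _ _ fun k hk => ?_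
      rw [Finset.mem_Icc] at hk
      rcases eq_or_ne k (p - 1) with rfl | hne
      -- The term k = p - 1 would have degree 2p, too large for the criterion, but H_{p-1}^{(2)} = 0
      -- removes it.
      · simp [hH]
      · exact (natDegree_C_mul_le _ _).trans (natDegree_pow_le.trans
          (Nat.mul_le_mul (by omega) natDegree_X_mul_one_sub_X_le))
    have h2 : ∀ f : (ZMod p)[X], f.natDegree ≤ 1 →
        (2 * f * truncPolylog (p - 1) 2 f).natDegree ≤ 1 + (p - 1) := fun f hf =>
      natDegree_mul_le.trans (Nat.add_le_add
        ((natDegree_C_mul_le 2 f).trans hf) (natDegree_truncPolylog_le p 2 hf))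
    have := natDegree_sub_le_of_le h1
      (natDegree_add_le_of_le (h2 _ natDegree_one_sub_X_le) (h2 _ natDegree_X_le))
    rw [max_self] at this
    refine this.trans_lt (max_lt ?_ ?_) <;> omega
  · simp only [eval_sub, eval_add, eval_mul]
    rw [eval_truncPolylog_of_eval_eq_one (f := 1 - X) _ _ (by simp), hH,
      eval_truncPolylog_of_eval_eq_zero (f := X) _ _ (by simp)]
    simp [eval_finsetSum]
  · simp only [eval_sub, eval_add, eval_mul]
    rw [eval_truncPolylog_of_eval_eq_zero (f := 1 - X) _ _ (by simp),
      eval_truncPolylog_of_eval_eq_one (f := X) _ _ (by simp), hH]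
    simp [eval_finsetSum]

/-! ### Reduction from `ℤ_[p]` to `ZMod p` -/

theorem toZMod_padicRecip (p : ℕ) [Fact p.Prime] (d k : ℕ) (hk : 0 < k) (hkp : k < p) :
    PadicInt.toZMod (padicRecip p d k) = ((k : ZMod p) ^ d)⁻¹ := by
  have hu : IsUnit ((k : ℤ_[p]) ^ d) := by
    refine IsUnit.pow d ?_
    rw [PadicInt.isUnit_iff, PadicInt.norm_natCast_eq_one_iff]
    exact Nat.coprime_of_lt_prime hk.ne' hkp Fact.out
  have h := congrArg PadicInt.toZMod (Ring.inverse_mul_cancel _ hu)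
  rw [map_mul, map_pow, map_natCast, map_one] at h
  exact eq_inv_of_mul_eq_one_left h

theorem toZMod_padicHarmonic (p : ℕ) [Fact p.Prime] (d k : ℕ) (hkp : k < p) :
    PadicInt.toZMod (padicHarmonic p d k) = fieldHarmonic (ZMod p) d k := by
  rw [padicHarmonic, map_sum, fieldHarmonic]
  refine Finset.sum_congr rfl fun j hj => ?_
  rw [Finset.mem_Icc] at hj
  exact toZMod_padicRecip p d j (by omega) (by omega)

theorem map_toZMod_finitePolylog (p : ℕ) [Fact p.Prime] (d : ℕ) (f : ℤ_[p][X]) :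
    (finitePolylog p d f).map PadicInt.toZMod
      = truncPolylog (p - 1) d (f.map PadicInt.toZMod) := by
  rw [finitePolylog, Polynomial.map_sum, truncPolylog]
  refine Finset.sum_congr rfl fun j hj => ?_
  rw [Finset.mem_Icc] at hj
  rw [Polynomial.map_mul, Polynomial.map_pow, map_C,
    toZMod_padicRecip p d j (by omega) (by omega)]

theorem smodEq_span_prime_iff_map_toZMod_eq (p : ℕ) [Fact p.Prime] (f g : ℤ_[p][X]) :
    f ≡ g [SMOD (Ideal.span {(p : ℤ_[p][X])} : Ideal ℤ_[p][X])] ↔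
      f.map PadicInt.toZMod = g.map PadicInt.toZMod := by
  rw [SModEq.sub_mem, Ideal.mem_span_singleton, ← map_natCast C, Polynomial.C_dvd_iff_dvd_coeff,
    ← sub_eq_zero (a := f.map _), ← Polynomial.map_sub, Polynomial.ext_iff]
  refine forall_congr' fun n => ?_
  rw [coeff_map, coeff_zero, ← RingHom.mem_ker, PadicInt.ker_toZMod,
    PadicInt.maximalIdeal_eq_span_p, Ideal.mem_span_singleton]

theorem sub_dvd_finitePolylog_sub (p : ℕ) [Fact p.Prime] (d : ℕ) (f g : ℤ_[p][X]) :
    f - g ∣ finitePolylog p d f - finitePolylog p d g := by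
  rw [finitePolylog, finitePolylog, ← Finset.sum_sub_distrib]
  refine Finset.dvd_sum fun k _ => ?_
  rw [← mul_sub]
  exact (sub_dvd_pow_sub_pow f g k).mul_left _

theorem mainTheorem3 (p : ℕ) [Fact p.Prime] (hp : 3 < p) (x α β : ℤ_[p][X])
    (hβ : β = X) (hα : α = 1 - β) (hx : x = β * (1 - β)) :
    (∃ Q : ℤ_[p][X],
      Q * (β - α) = 2 * finitePolylog p 2 α - 2 * finitePolylog p 2 β ∧
      ∑ k ∈ Finset.Icc 1 (p - 1),
          (((2 * k).choose k : ℕ) : ℤ_[p][X]) * C (padicHarmonic p 2 k) * x ^ k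
        ≡ Q [SMOD (Ideal.span {(p : ℤ_[p][X])} : Ideal ℤ_[p][X])]) ∧
    ∑ k ∈ Finset.Icc 1 (p - 1),
        ((catalan k : ℕ) : ℤ_[p][X]) * C (padicHarmonic p 2 k) * x ^ (k + 1)
      ≡ 2 * α * finitePolylog p 2 α + 2 * β * finitePolylog p 2 β
        [SMOD (Ideal.span {(p : ℤ_[p][X])} : Ideal ℤ_[p][X])] := by
  subst hx hα hβ
  have hsum : ∀ (a : ℕ → ℕ) (e : ℕ → ℕ),
      (∑ k ∈ Finset.Icc 1 (p - 1), ((a k : ℕ) : ℤ_[p][X]) * C (padicHarmonic p 2 k) *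
        (X * (1 - X)) ^ e k).map PadicInt.toZMod
      = ∑ k ∈ Finset.Icc 1 (p - 1), C ((a k : ZMod p) * fieldHarmonic (ZMod p) 2 k) *
        (X * (1 - X)) ^ e k := by
    intro a e
    rw [Polynomial.map_sum]
    refine Finset.sum_congr rfl fun k hk => ?_
    rw [Finset.mem_Icc] at hk
    simp [toZMod_padicHarmonic p 2 k (by omega)]
  refine ⟨?_, ?_⟩
  · obtain ⟨Q, hQ⟩ := sub_dvd_finitePolylog_sub p 2 X (1 - X)
    have hQ' : -2 * Q * (X - (1 - X))
        = 2 * finitePolylog p 2 (1 - X) - 2 * finitePolylog p 2 X := by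
      linear_combination 2 * hQ
    -- `Q` divides £_2(β) - £_2(α) by β - α, hence the sign. Modulo p the factor β - α = 2X - 1 is
    -- nonzero and can be cancelled.
    refine ⟨-2 * Q, hQ', ?_⟩
    rw [smodEq_span_prime_iff_map_toZMod_eq, hsum (fun k => (2 * k).choose k) (fun k => k)]
    have h := congrArg (Polynomial.map PadicInt.toZMod) hQ'
    simp only [Polynomial.map_mul, Polynomial.map_sub, map_toZMod_finitePolylog, Polynomial.map_one,
      map_X, Polynomial.map_ofNat] at h
    rw [← two_X_sub_one_mul_sum_centralBinom_harmonic p hp] at h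
    have hne : (2 * X - 1 : (ZMod p)[X]) ≠ 0 := fun h0 => by
      simpa using congrArg (eval 0) h0
    refine mul_left_cancel₀ hne ?_
    simp only [Nat.centralBinom] at h
    rw [Polynomial.map_mul]
    linear_combination -h
  · rw [smodEq_span_prime_iff_map_toZMod_eq, hsum catalan (fun k => k + 1),
      sum_catalan_harmonic p hp]
    simp [map_toZMod_finitePolylog]
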